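/- For non-negative integers put $$f_{s,t}(b,n,m,a)=\binom{b}{s}\binom{m-a}{t}+\binom{a}{s}\binom{n}{t}-\binom{a}{s}\binom{m-a}{t}\qquad(a\le m),$$ and let $f^*_{s,t}=f_{s,t}$ if $s=t$ and $f^*_{s,t}=f_{s,t}+f_{t,s}$ if $s\ne t$. For a finite simple graph $G$ let $N(K_{s,t},G)$ be the number of (not necessarily induced) copies of the complete bipartite graph $K_{s,t}$ in $G$, that is, the number of subgraphs of $G$ isomorphic to $K_{s,t}$. Let $s,t,r\ge 1$, $k\ge 0$ and $b\ge n\ge 2k+2r$ be integers, let $h=\lfloor\frac{n-k-1}{2}\rfloor$, and put $$\Phi=\max\{f^*_{s,t}(b,n,n-k-1,r),\ f^*_{s,t}(b,n,n-k-1,h)\}.$$ (a) Let $G$ be a connected bipartite graph with bipartition $(X,Y)$, $|X|=n$, $|Y|=b$, and minimum degree $\delta(G)\ge r$. If $N(K_{s,t},G)>\Phi$, then $G$ contains a matching with $n-k$ edges. (b) If moreover $2r\le n-k-1$ (that is, unless $k=0$ and $n=2r$), then $\Phi$ is exactly the maximum of $N(K_{s,t},G)$ over all connected bipartite graphs $G$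 with parts of sizes $n$ and $b$ and $\delta(G)\ge r$ that contain no matching with $n-k$ edges. -/

import Mathlib

namespace BipTuran

/-- `f_{s,t}(b,n,m,a) = C(b,s) C(m-a,t) + C(a,s) C(n,t) - C(a,s) C(m-a,t)`, as an integer.
It is used for `a ≤ m` only, where the natural subtraction `m - a` is the true one. -/
def f (s t b n m a : ℕ) : ℤ :=
  (b.choose s : ℤ) * ((m - a).choose t : ℤ) + (a.choose s : ℤ) * (n.choose t : ℤ)
    - (a.choose s : ℤ) * ((m - a).choose t : ℤ)

/-- `f_{s,s}` if `s = t`, and `f_{s,t} + f_{t,s}` if `s ≠ t`. -/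
def fSym (s t b n m a : ℕ) : ℤ :=
  if s = t then f s t b n m a else f s t b n m a + f t s b n m a

/-- `N(K_{s,t}, G)`: the number of (not necessarily induced, unlabelled) copies of `K_{s,t}`
in `G`, that is, of subgraphs of `G` isomorphic to `K_{s,t}`. -/
noncomputable def numK {V : Type*} [Fintype V] (s t : ℕ) (G : SimpleGraph V) : ℕ :=
  G.copyCount (completeBipartiteGraph (Fin s) (Fin t))

/-- `G` contains a matching with exactly `m` edges. -/
def HasMatching {V : Type*} (G : SimpleGraph V) (m : ℕ) : Prop :=
  ∃ M : G.Subgraph, M.IsMatching ∧ M.edgeSet.ncard = m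

open Classical in
/-- `G` is a connected bipartite graph with bipartition `(X, Y)`, where `|X| = n` and `|Y| = b`,
and with minimum degree at least `r`. -/
structure IsConnBip {V : Type*} [Fintype V] (G : SimpleGraph V) (X Y : Set V) (b n r : ℕ) :
    Prop where
  bipartite : G.IsBipartiteWith X Y
  cover : X ∪ Y = Set.univ
  card_left : X.ncard = n
  card_right : Y.ncard = b
  connected : G.Connected
  le_minDegree : r ≤ G.minDegree

/-- The numbers of copies of `K_{s,t}` in connected bipartite graphs with parts of sizes `n` and `b`
and minimum degree at least `r` that contain no matching with `m` edges. The maximum of this set is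
`ex_bip(b, n, K_{s,t}, M_m)` restricted to connected graphs of minimum degree at least `r`. -/
def matchingFreeCounts (b n r s t m : ℕ) : Set ℤ :=
  {N | ∃ (V : Type) (_ : Fintype V) (G : SimpleGraph V) (X Y : Set V),
    IsConnBip G X Y b n r ∧ ¬ HasMatching G m ∧ N = (numK s t G : ℤ)}

end BipTuran

namespace BipTuran

/-! Put `m = n - k - 1`. Without a matching of `m + 1` edges, König's theorem gives a vertex cover
`A ∪ B` with `A ⊆ X`, `B ⊆ Y` and, after padding, `|A| + |B| = m`. As `m < n ≤ b`, some vertex on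
each side lies outside the cover; its neighbours all lie in the opposite part of the cover, so `|A|,
|B| ≥ r`.

A copy of `K_{s,t}` with sides `S ⊆ Y`, `T ⊆ X` has `T ⊆ A` or `S ⊆ B`. Inclusion–exclusion bounds
the number of such pairs by `f s t b n m |B|`, and adding the other orientation when `s ≠ t` gives
`fSym` (`numK_le_fSym`).

With `a = |B|` in `[r, m - r]`, `fSym` is convex in `a` and does not decrease when `a ≥ m / 2` is
replaced by `m - a`. Hence it is at most its larger value at `r` and `m / 2` (`fSym_le_max`). The
bound is attained by the graph of all edges meeting a cover with parts of sizes `m - a` and `a`. -/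

/-! ### Convexity and reflection of `fSym`. -/

theorem le_max_of_discrete_convex (g : ℕ → ℤ) (l u : ℕ)
    (hg : ∀ i, l ≤ i → i + 2 ≤ u → 2 * g (i + 1) ≤ g i + g (i + 2)) :
    ∀ a, l ≤ a → a ≤ u → g a ≤ max (g l) (g u) := by
  induction u with
  | zero =>
    intro a h1 h2
    obtain rfl : a = 0 := by omega
    exact le_max_right _ _
  | succ u ih =>
    intro a h1 h2
    have ih' := ih (fun i h3 h4 => hg i h3 (by omega))
    rcases h2.eq_or_lt with rfl | h2
    · exact le_max_right _ _
    have h3 := ih' a h1 (by omega)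
    suffices h : g u ≤ max (g l) (g (u + 1)) from
      h3.trans (max_le (le_max_left _ _) h)
    by_cases hlu : l = u
    · subst hlu; exact le_max_left _ _
    obtain ⟨v, rfl⟩ : ∃ v, u = v + 1 := ⟨u - 1, by omega⟩
    have h4 := hg v (by omega) (by omega)
    have h5 := ih' v (by omega) (by omega)
    -- If `g u > g (u + 1)`, convexity gives `g v > g u`; then `h5` forces `g v ≤ g l`, so `g u < g
    -- l`.
    grind

theorem choose_convex (a s : ℕ) (hs : 1 ≤ s) :
    a.choose s ≤ (a + 1).choose s ∧
      2 * (a + 1).choose s ≤ a.choose s + (a + 2).choose s := by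
  obtain ⟨s, rfl⟩ : ∃ s', s = s' + 1 := ⟨s - 1, by omega⟩
  have h1 := Nat.choose_succ_succ a s
  have h2 : (a + 2).choose (s + 1) = (a + 1).choose s + (a + 1).choose (s + 1) :=
    Nat.choose_succ_succ (a + 1) s
  have h3 : a.choose s ≤ (a + 1).choose s := Nat.choose_le_choose s (by omega)
  simp only [Nat.succ_eq_add_one] at *
  omega

/-- The second difference is exactly the sum of the four products `r1`–`r4`. The mixed term `-C(a,s)
C(m-a,t)` is harmless: one factor increases in `a`, the other decreases, and its remaining part is
absorbed because `C(b,s)` and `C(n,t)` dominate. -/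
theorem f_convex {s t b n m a : ℕ} (hs : 1 ≤ s) (ht : 1 ≤ t) (hmn : m ≤ n) (hnb : n ≤ b)
    (ha : a + 2 ≤ m) :
    2 * f s t b n m (a + 1) ≤ f s t b n m a + f s t b n m (a + 2) := by
  obtain ⟨d, rfl⟩ : ∃ d, m = a + 2 + d := ⟨m - (a + 2), by omega⟩
  have e0 : a + 2 + d - a = d + 2 := by omega
  have e1 : a + 2 + d - (a + 1) = d + 1 := by omega
  have e2 : a + 2 + d - (a + 2) = d := by omega
  unfold f
  rw [e0, e1, e2]
  obtain ⟨p1, p2⟩ := choose_convex a s hs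
  obtain ⟨q1, q2⟩ := choose_convex d t ht
  have hB : (a + 1).choose s ≤ b.choose s := Nat.choose_le_choose s (by omega)
  have hN : (d + 1).choose t ≤ n.choose t := Nat.choose_le_choose t (by omega)
  generalize a.choose s = x0 at *
  generalize (a + 1).choose s = x1 at *
  generalize (a + 2).choose s = x2 at *
  generalize d.choose t = y0 at *
  generalize (d + 1).choose t = y1 at *
  generalize (d + 2).choose t = y2 at *
  generalize b.choose s = B at *
  generalize n.choose t = N at *
  zify at *
  have r1 := mul_nonneg (sub_nonneg.2 hB) (sub_nonneg.2 q2)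
  have r2 := mul_nonneg (sub_nonneg.2 hN) (sub_nonneg.2 p2)
  have hy : (y1 : ℤ) ≤ y2 := by linarith
  have hx : (x1 : ℤ) ≤ x2 := by linarith
  have r3 := mul_nonneg (sub_nonneg.2 p1) (sub_nonneg.2 hy)
  have r4 := mul_nonneg (sub_nonneg.2 hx) (sub_nonneg.2 q1)
  linarith

theorem fSym_convex {s t b n m a : ℕ} (hs : 1 ≤ s) (ht : 1 ≤ t) (hmn : m ≤ n) (hnb : n ≤ b)
    (ha : a + 2 ≤ m) :
    2 * fSym s t b n m (a + 1) ≤ fSym s t b n m a + fSym s t b n m (a + 2) := by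
  unfold fSym
  have h1 := f_convex hs ht hmn hnb ha
  have h2 := f_convex ht hs hmn hnb ha
  split_ifs <;> linarith

/-- Reflection swaps the mixed terms of `f s t` and `f t s`, so they cancel; what remains is the
products `r1` and `r2`. It is better to have the larger part of the cover in the smaller side. -/
theorem f_add_f_le_reflect {s t b n m a : ℕ} (hnb : n ≤ b) (ham : a ≤ m) (ha : m ≤ 2 * a) :
    f s t b n m a + f t s b n m a ≤ f s t b n m (m - a) + f t s b n m (m - a) := by
  unfold f
  rw [Nat.sub_sub_self ham]
  have h1 : n.choose s ≤ b.choose s := Nat.choose_le_choose s hnb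
  have h2 : n.choose t ≤ b.choose t := Nat.choose_le_choose t hnb
  have h3 : (m - a).choose s ≤ a.choose s := Nat.choose_le_choose s (by omega)
  have h4 : (m - a).choose t ≤ a.choose t := Nat.choose_le_choose t (by omega)
  zify at h1 h2 h3 h4
  have r1 := mul_nonneg (sub_nonneg.2 h2) (sub_nonneg.2 h3)
  have r2 := mul_nonneg (sub_nonneg.2 h1) (sub_nonneg.2 h4)
  linarith

theorem fSym_le_reflect {s t b n m a : ℕ} (hnb : n ≤ b) (ham : a ≤ m) (ha : m ≤ 2 * a) :
    fSym s t b n m a ≤ fSym s t b n m (m - a) := by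
  have h := f_add_f_le_reflect (s := s) (t := t) hnb ham ha
  unfold fSym
  split_ifs with hst
  · subst hst; linarith
  · exact h

theorem fSym_le_max {s t b n m r a : ℕ} (hs : 1 ≤ s) (ht : 1 ≤ t) (hmn : m ≤ n) (hnb : n ≤ b)
    (hra : r ≤ a) (ham : a + r ≤ m) :
    fSym s t b n m a ≤ max (fSym s t b n m r) (fSym s t b n m (m / 2)) := by
  have key := le_max_of_discrete_convex (fSym s t b n m) r (m / 2)
    (fun i _ _ => fSym_convex hs ht hmn hnb (by omega))
  by_cases h : a ≤ m / 2
  · exact key a hra h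
  · exact (fSym_le_reflect hnb (by omega) (by omega)).trans (key (m - a) (by omega) (by omega))

/-! ### Matchings, vertex covers and König's theorem. -/

section Matching

variable {V : Type*} {G : SimpleGraph V}

theorem hasMatching_of_injOn (S : Finset V) (g : V → V) (hg : Set.InjOn g S)
    (hS : ∀ x ∈ S, g x ∉ S) (hadj : ∀ x ∈ S, G.Adj x (g x)) : HasMatching G S.card := by
  classical
  let M : G.Subgraph :=
    { verts := {v | v ∈ S ∨ ∃ x ∈ S, g x = v}
      Adj := fun v w => (v ∈ S ∧ g v = w) ∨ (w ∈ S ∧ g w = v)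
      adj_sub := by
        rintro v w (⟨h, rfl⟩ | ⟨h, rfl⟩)
        · exact hadj _ h
        · exact (hadj _ h).symm
      edge_vert := by
        rintro v w (⟨h, rfl⟩ | ⟨h, rfl⟩)
        · exact Or.inl h
        · exact Or.inr ⟨w, h, rfl⟩
      symm := ⟨fun v w h => h.symm⟩ }
  refine ⟨M, ?_, ?_⟩
  · rintro v (h | ⟨x, h, rfl⟩)
    · refine ⟨g v, Or.inl ⟨h, rfl⟩, ?_⟩
      rintro w (⟨_, rfl⟩ | ⟨hw, rfl⟩)
      · rfl
      · exact absurd h (hS _ hw)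
    · refine ⟨x, Or.inr ⟨h, rfl⟩, ?_⟩
      rintro w (⟨hw, rfl⟩ | ⟨hw, hwx⟩)
      · exact absurd hw (hS _ h)
      · exact hg hw h hwx
  · have he : M.edgeSet = (fun x => s(x, g x)) '' (S : Set V) := by
      ext e
      induction e using Sym2.ind with
      | _ v w =>
        simp only [SimpleGraph.Subgraph.mem_edgeSet, Set.mem_image, Finset.mem_coe, Sym2.eq_iff]
        constructor
        · rintro (⟨h, rfl⟩ | ⟨h, rfl⟩)
          · exact ⟨v, h, Or.inl ⟨rfl, rfl⟩⟩
          · exact ⟨w, h, Or.inr ⟨rfl, rfl⟩⟩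
        · rintro ⟨x, h, ⟨rfl, rfl⟩ | ⟨rfl, rfl⟩⟩
          · exact Or.inl ⟨h, rfl⟩
          · exact Or.inr ⟨h, rfl⟩
    rw [he, Set.InjOn.ncard_image, Set.ncard_coe_finset]
    intro x hx y hy hxy
    rcases Sym2.eq_iff.1 hxy with ⟨h, _⟩ | ⟨h, _⟩
    · exact h
    · exact absurd (h ▸ hx) (hS y hy)

theorem ncard_edgeSet_le_of_cover {M : G.Subgraph} (hM : M.IsMatching) (C : Finset V)
    (hC : ∀ v w, G.Adj v w → v ∈ C ∨ w ∈ C) : M.edgeSet.ncard ≤ C.card := by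
  classical
  -- Each vertex is sent to its matching edge. The loop at an unmatched vertex is a default value
  -- that can only enlarge the image.
  let g : V → Sym2 V := fun v => if h : ∃ w, M.Adj v w then s(v, h.choose) else s(v, v)
  have hg : ∀ v w, M.Adj v w → g v = s(v, w) := by
    intro v w h
    have h' : ∃ w, M.Adj v w := ⟨w, h⟩
    simp only [g, dif_pos h']
    rw [(hM (M.edge_vert h)).unique h'.choose_spec h]
  have hsub : M.edgeSet ⊆ (C.image g : Finset (Sym2 V)) := by
    intro e
    induction e using Sym2.ind with
    | _ v w =>
      intro h
      have h : M.Adj v w := h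
      rw [Finset.coe_image]
      rcases hC v w h.adj_sub with hv | hw
      · exact ⟨v, hv, hg v w h⟩
      · exact ⟨w, hw, (hg w v h.symm).trans Sym2.eq_swap⟩
  calc M.edgeSet.ncard ≤ (C.image g : Finset (Sym2 V)).card := by
        rw [← Set.ncard_coe_finset]
        exact Set.ncard_le_ncard hsub (Finset.finite_toSet _)
    _ ≤ C.card := Finset.card_image_le

/-- **König's theorem** for a bipartite graph, in the form obtained from Hall's theorem by adding
dummy vertices. -/
theorem exists_cover_of_not_hasMatching [Fintype V] {X Y : Finset V}
    (hG : G.IsBipartiteWith (X : Set V) Y) {m : ℕ} (hm : m < X.card)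
    (hM : ¬ HasMatching G (m + 1)) :
    ∃ A ⊆ X, ∃ B ⊆ Y, A.card + B.card = m ∧ ∀ x ∈ X, ∀ y, G.Adj x y → x ∈ A ∨ y ∈ B := by
  classical
  obtain ⟨k, hk⟩ : ∃ k, X.card = m + 1 + k := ⟨X.card - (m + 1), by omega⟩
  -- Every `x` is joined to `k = |X| - m - 1` dummies, so a system of distinct representatives uses
  -- at least `m + 1` genuine edges.
  let nb : X → Finset (V ⊕ Fin k) := fun x => (G.neighborFinset x).disjSum Finset.univ
  by_cases hall : ∀ S : Finset X, S.card ≤ (S.biUnion nb).card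
  · exfalso
    obtain ⟨φ, hφ, hφn⟩ := (Finset.all_card_le_biUnion_card_iff_exists_injective nb).1 hall
    let S : Finset X := Finset.univ.filter fun x => (φ x).isLeft
    have hS : m + 1 ≤ S.card := by
      have h1 : (Finset.univ.filter fun x : X => ¬ (φ x).isLeft).card ≤ k := by
        calc _ = ((Finset.univ.filter fun x : X => ¬ (φ x).isLeft).image φ).card :=
              (Finset.card_image_of_injective _ hφ).symm
          _ ≤ ((Finset.univ : Finset (Fin k)).image Sum.inr).card := by
              apply Finset.card_le_card
              intro z hz
              simp only [Finset.mem_image, Finset.mem_filter, Finset.mem_univ, true_and] at hz ⊢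
              obtain ⟨x, hx, rfl⟩ := hz
              rcases h : φ x with y | i
              · simp [h] at hx
              · exact ⟨i, rfl⟩
          _ ≤ k := by simpa using Finset.card_image_le (s := (Finset.univ : Finset (Fin k)))
      have h2 := Finset.card_filter_add_card_filter_not (s := (Finset.univ : Finset X))
        (fun x : X => ((φ x).isLeft : Prop))
      rw [Finset.card_univ, Fintype.card_coe] at h2
      simp only [S]
      omega
    obtain ⟨S', hS'S, hS'⟩ := Finset.exists_subset_card_eq hS
    have hleft : ∀ x ∈ S', ∃ y, φ x = Sum.inl y ∧ G.Adj x y := by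
      intro x hx
      have h1 := (Finset.mem_filter.1 (hS'S hx)).2
      obtain ⟨y, hy⟩ := Sum.isLeft_iff.1 h1
      refine ⟨y, hy, ?_⟩
      have h2 := hφn x
      rw [hy] at h2
      simpa [nb] using h2
    let g : V → V := fun v =>
      if h : v ∈ X then (φ ⟨v, h⟩).elim id (fun _ => v) else v
    have hgv : ∀ x (hx : x ∈ S'), φ x = Sum.inl (g x) ∧ G.Adj x (g x) := by
      intro x hx
      obtain ⟨y, hy, hadj⟩ := hleft x hx
      have : g x = y := by simp [g, hy]
      rw [this]; exact ⟨hy, hadj⟩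
    apply hM
    have key := hasMatching_of_injOn (G := G) (S'.map (Function.Embedding.subtype _)) g ?_ ?_ ?_
    · rwa [Finset.card_map, hS'] at key
    · intro x hx y hy hxy
      simp only [Finset.coe_map, Set.mem_image, Finset.mem_coe] at hx hy
      obtain ⟨x, hx, rfl⟩ := hx
      obtain ⟨y, hy, rfl⟩ := hy
      have : φ x = φ y := by
        rw [(hgv x hx).1, (hgv y hy).1]
        exact congrArg Sum.inl hxy
      rw [hφ this]
    · intro x hx hgx
      obtain ⟨x, hx', rfl⟩ := Finset.mem_map.1 hx
      obtain ⟨y, hy, hyx⟩ := Finset.mem_map.1 hgx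
      have hY := hG.mem_of_mem_adj x.2 (hgv x hx').2
      have hX : g x ∈ X := by
        have := y.2
        rw [← Function.Embedding.subtype_apply, hyx] at this
        exact this
      exact Set.disjoint_left.1 hG.disjoint hX hY
    · intro x hx
      obtain ⟨x, hx', rfl⟩ := Finset.mem_map.1 hx
      exact (hgv x hx').2
  · push Not at hall
    obtain ⟨S, hS⟩ := hall
    set S' : Finset V := S.map (Function.Embedding.subtype _) with hS'
    have hS'X : S' ⊆ X := by
      intro x hx
      obtain ⟨x, _, rfl⟩ := Finset.mem_map.1 hx
      exact x.2
    have hS'c : S'.card = S.card := Finset.card_map _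
    let B : Finset V := S'.biUnion fun x => G.neighborFinset x
    have hB : B.card + k ≤ (S.biUnion nb).card := by
      have : B.disjSum (Finset.univ : Finset (Fin k)) ⊆ S.biUnion nb := by
        intro z hz
        have hne : S.Nonempty := by
          rw [← Finset.card_pos]; omega
        obtain ⟨x0, hx0⟩ := hne
        rcases z with y | i
        · simp only [Finset.inl_mem_disjSum, B, Finset.mem_biUnion] at hz
          obtain ⟨x, hx, hy⟩ := hz
          obtain ⟨x, hx', rfl⟩ := Finset.mem_map.1 hx
          exact Finset.mem_biUnion.2 ⟨x, hx', Finset.inl_mem_disjSum.2 hy⟩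
        · exact Finset.mem_biUnion.2 ⟨x0, hx0, Finset.inr_mem_disjSum.2 (Finset.mem_univ _)⟩
      simpa [Finset.card_disjSum] using Finset.card_le_card this
    have hBY : B ⊆ Y := by
      intro y hy
      simp only [B, Finset.mem_biUnion, SimpleGraph.mem_neighborFinset] at hy
      obtain ⟨x, hx, hxy⟩ := hy
      exact hG.mem_of_mem_adj (hS'X hx) hxy
    have hA0 : (X \ S').card = X.card - S'.card := Finset.card_sdiff_of_subset hS'X
    have hSX := Finset.card_le_card hS'X
    -- The Hall violation `|B| + k < |S|` gives `|X \ S'| + |B| ≤ m`; `X \ S'` is padded inside `X`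
    -- to make the total exactly `m`.
    obtain ⟨A, hA1, hA2, hA3⟩ := Finset.exists_subsuperset_card_eq
      (s := X \ S') (t := X) (n := m - B.card) Finset.sdiff_subset (by omega) (by omega)
    refine ⟨A, hA2, B, hBY, by omega, ?_⟩
    intro x hx y hxy
    by_cases hxS : x ∈ S'
    · right
      exact Finset.mem_biUnion.2 ⟨x, hxS, by simpa using hxy⟩
    · exact Or.inl (hA1 (Finset.mem_sdiff.2 ⟨hx, hxS⟩))

end Matching

/-! ### Counting copies of `K_{s,t}` through pairs of vertex sets. -/

section Counting

variable {V : Type*} {G : SimpleGraph V}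

open Classical in
/-- The complete bipartite pairs of `G` with `s` vertices in `Y` and `t` vertices in `X`. -/
noncomputable def bicliques (G : SimpleGraph V) (X Y : Finset V) (s t : ℕ) :
    Finset (Finset V × Finset V) :=
  (Y.powersetCard s ×ˢ X.powersetCard t).filter fun p => ∀ v ∈ p.1, ∀ w ∈ p.2, G.Adj v w

theorem mem_bicliques {X Y : Finset V} {s t : ℕ} {p : Finset V × Finset V} :
    p ∈ bicliques G X Y s t ↔
      ((p.1 ⊆ Y ∧ p.1.card = s) ∧ (p.2 ⊆ X ∧ p.2.card = t)) ∧
        ∀ v ∈ p.1, ∀ w ∈ p.2, G.Adj v w := by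
  simp only [bicliques, Finset.mem_filter, Finset.mem_product, Finset.mem_powersetCard]

theorem nonempty_iso_coe_of_pair {H : G.Subgraph} {S T : Finset V}
    (hd : Disjoint S T) (hv : ∀ v, v ∈ H.verts ↔ v ∈ S ∨ v ∈ T)
    (hadj : ∀ v w, H.Adj v w ↔ (v ∈ S ∧ w ∈ T) ∨ (v ∈ T ∧ w ∈ S)) :
    Nonempty (completeBipartiteGraph (Fin S.card) (Fin T.card) ≃g H.coe) := by
  have hST : ∀ v, v ∈ S → v ∈ T → False := fun v h1 h2 => Finset.disjoint_left.1 hd h1 h2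
  let φ : Fin S.card ⊕ Fin T.card → H.verts := Sum.elim
    (fun i => ⟨S.equivFin.symm i, (hv _).2 (Or.inl (S.equivFin.symm i).2)⟩)
    (fun i => ⟨T.equivFin.symm i, (hv _).2 (Or.inr (T.equivFin.symm i).2)⟩)
  have hφ : Function.Bijective φ := by
    constructor
    · rintro (i | i) (j | j) h
      · simpa [φ, Subtype.ext_iff] using h
      · have h := congrArg Subtype.val h
        simp only [φ, Sum.elim_inl, Sum.elim_inr] at h
        exact (hST _ (S.equivFin.symm i).2 (h ▸ (T.equivFin.symm j).2)).elim
      · have h := congrArg Subtype.val h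
        simp only [φ, Sum.elim_inl, Sum.elim_inr] at h
        exact (hST _ (S.equivFin.symm j).2 (h ▸ (T.equivFin.symm i).2)).elim
      · simpa [φ, Subtype.ext_iff] using h
    · rintro ⟨v, hvv⟩
      rcases (hv v).1 hvv with h | h
      · exact ⟨Sum.inl (S.equivFin ⟨v, h⟩), by simp [φ]⟩
      · exact ⟨Sum.inr (T.equivFin ⟨v, h⟩), by simp [φ]⟩
  refine ⟨⟨Equiv.ofBijective φ hφ, ?_⟩⟩
  have hS : ∀ i, ((S.equivFin.symm i : S) : V) ∈ S := fun i => (S.equivFin.symm i).2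
  have hT : ∀ i, ((T.equivFin.symm i : T) : V) ∈ T := fun i => (T.equivFin.symm i).2
  have hS' : ∀ i, ((S.equivFin.symm i : S) : V) ∉ T := fun i h => hST _ (hS i) h
  have hT' : ∀ i, ((T.equivFin.symm i : T) : V) ∉ S := fun i h => hST _ h (hT i)
  rintro (i | i) (j | j) <;>
    simp [φ, SimpleGraph.Subgraph.coe_adj, hadj, hS, hT, hS', hT']

theorem exists_pair_of_iso_coe {s t : ℕ} {H : G.Subgraph}
    (φ : completeBipartiteGraph (Fin s) (Fin t) ≃g H.coe) :
    ∃ S T : Finset V, S.card = s ∧ T.card = t ∧ (∀ v, v ∈ H.verts ↔ v ∈ S ∨ v ∈ T) ∧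
      ∀ v w, H.Adj v w ↔ (v ∈ S ∧ w ∈ T) ∨ (v ∈ T ∧ w ∈ S) := by
  classical
  have hinj : Function.Injective fun x => (φ x : V) :=
    Subtype.val_injective.comp φ.injective
  let S : Finset V := Finset.univ.image fun i : Fin s => (φ (Sum.inl i) : V)
  let T : Finset V := Finset.univ.image fun i : Fin t => (φ (Sum.inr i) : V)
  have hS : ∀ x, (φ x : V) ∈ S ↔ x.isLeft := by
    rintro (i | i)
    · simp only [S, Finset.mem_image, Finset.mem_univ, true_and, Sum.isLeft_inl, iff_true]
      exact ⟨i, rfl⟩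
    · simp only [S, Finset.mem_image, Finset.mem_univ, true_and, Sum.isLeft_inr]
      constructor
      · rintro ⟨j, hj⟩
        cases hinj hj
      · simp
  have hT : ∀ x, (φ x : V) ∈ T ↔ x.isRight := by
    rintro (i | i)
    · simp only [T, Finset.mem_image, Finset.mem_univ, true_and, Sum.isRight_inl]
      constructor
      · rintro ⟨j, hj⟩
        cases hinj hj
      · simp
    · simp only [T, Finset.mem_image, Finset.mem_univ, true_and, Sum.isRight_inr, iff_true]
      exact ⟨i, rfl⟩
  have hSv : ∀ v ∈ S, v ∈ H.verts := by
    intro v hv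
    obtain ⟨i, _, rfl⟩ := Finset.mem_image.1 hv
    exact (φ _).2
  have hTv : ∀ v ∈ T, v ∈ H.verts := by
    intro v hv
    obtain ⟨i, _, rfl⟩ := Finset.mem_image.1 hv
    exact (φ _).2
  have hsurj : ∀ v ∈ H.verts, ∃ x, (φ x : V) = v := by
    intro v hv
    obtain ⟨x, hx⟩ := φ.surjective ⟨v, hv⟩
    exact ⟨x, congrArg Subtype.val hx⟩
  refine ⟨S, T, ?_, ?_, ?_, ?_⟩
  · rw [Finset.card_image_of_injective, Finset.card_univ, Fintype.card_fin]
    exact hinj.comp Sum.inl_injective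
  · rw [Finset.card_image_of_injective, Finset.card_univ, Fintype.card_fin]
    exact hinj.comp Sum.inr_injective
  · intro v
    refine ⟨fun h => ?_, fun h => h.elim (hSv v) (hTv v)⟩
    obtain ⟨x, rfl⟩ := hsurj v h
    rw [hS, hT]
    cases x <;> simp
  · intro v w
    constructor
    · intro h
      obtain ⟨x, rfl⟩ := hsurj v (H.edge_vert h)
      obtain ⟨y, rfl⟩ := hsurj w (H.edge_vert h.symm)
      rw [hS, hT, hS, hT]
      exact φ.map_rel_iff.1 (show H.coe.Adj (φ x) (φ y) from h)
    · intro h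
      have hv : v ∈ H.verts := h.elim (fun h => hSv _ h.1) (fun h => hTv _ h.1)
      have hw : w ∈ H.verts := h.elim (fun h => hTv _ h.2) (fun h => hSv _ h.2)
      obtain ⟨x, rfl⟩ := hsurj v hv
      obtain ⟨y, rfl⟩ := hsurj w hw
      rw [hS, hT, hS, hT] at h
      exact (φ.map_rel_iff (a := x) (b := y)).2 h

/-- The subgraph consisting of the edges of `G` between `S` and `T`, on the vertex set `S ∪ T`. -/
def pairSubgraph (G : SimpleGraph V) (p : Finset V × Finset V) : G.Subgraph where
  verts := {v | v ∈ p.1 ∨ v ∈ p.2}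
  Adj v w := G.Adj v w ∧ ((v ∈ p.1 ∧ w ∈ p.2) ∨ (v ∈ p.2 ∧ w ∈ p.1))
  adj_sub h := h.1
  edge_vert h := h.2.elim (fun h => Or.inl h.1) (fun h => Or.inr h.1)
  symm := ⟨fun _ _ h => ⟨h.1.symm, h.2.symm.imp And.symm And.symm⟩⟩

-- A copy is determined by its vertex set, split by `Y` and `X`. A union is taken because the two
-- orientations coincide when `s = t`.
open Classical in
theorem numK_eq_card_bicliques [Fintype V] {X Y : Finset V}
    (hG : G.IsBipartiteWith (X : Set V) Y) {s t : ℕ} (hs : 1 ≤ s) (ht : 1 ≤ t) :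
    numK s t G = (bicliques G X Y s t ∪ bicliques G X Y t s).card := by
  have hXY : ∀ v, v ∈ X → v ∈ Y → False := fun v h1 h2 =>
    Set.disjoint_left.1 hG.disjoint h1 h2
  unfold numK SimpleGraph.copyCount
  symm
  have hadj : ∀ {a b : ℕ} {p}, p ∈ bicliques G X Y a b → ∀ v w,
      (pairSubgraph G p).Adj v w ↔ (v ∈ p.1 ∧ w ∈ p.2) ∨ (v ∈ p.2 ∧ w ∈ p.1) := by
    intro a b p hp v w
    have hp := (mem_bicliques.1 hp).2
    refine ⟨fun h => h.2, fun h => ⟨?_, h⟩⟩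
    rcases h with h | h
    · exact hp _ h.1 _ h.2
    · exact (hp _ h.2 _ h.1).symm
  have hdisj : ∀ {a b : ℕ} {p}, p ∈ bicliques G X Y a b → Disjoint p.1 p.2 := by
    intro a b p hp
    have hp := (mem_bicliques.1 hp).1
    exact Finset.disjoint_left.2 fun v h1 h2 => hXY v (hp.2.1 h2) (hp.1.1 h1)
  have hsub : ∀ p ∈ bicliques G X Y s t ∪ bicliques G X Y t s, p.1 ⊆ Y ∧ p.2 ⊆ X := by
    intro p hp
    rcases Finset.mem_union.1 hp with hp | hp <;>
      exact ⟨(mem_bicliques.1 hp).1.1.1, (mem_bicliques.1 hp).1.2.1⟩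
  refine Finset.card_bij (fun p _ => pairSubgraph G p) ?_ ?_ ?_
  · intro p hp
    rw [Finset.mem_filter]
    refine ⟨Finset.mem_univ _, ?_⟩
    rcases Finset.mem_union.1 hp with hp | hp
    · have h := nonempty_iso_coe_of_pair (H := pairSubgraph G p) (hdisj hp)
        (fun _ => Iff.rfl) (hadj hp)
      have hc := (mem_bicliques.1 hp).1
      rwa [hc.1.2, hc.2.2] at h
    · have h := nonempty_iso_coe_of_pair (H := pairSubgraph G p) (hdisj hp).symm
        (fun _ => or_comm) (fun v w => (hadj hp v w).trans or_comm)
      have hc := (mem_bicliques.1 hp).1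
      rwa [hc.1.2, hc.2.2] at h
  · intro p hp q hq hpq
    have hv : ∀ v, (v ∈ p.1 ∨ v ∈ p.2) ↔ (v ∈ q.1 ∨ v ∈ q.2) := fun v =>
      Set.ext_iff.1 (congrArg SimpleGraph.Subgraph.verts hpq) v
    have hp := hsub p hp
    have hq := hsub q hq
    refine Prod.ext (Finset.ext fun v => ?_) (Finset.ext fun v => ?_)
    · have h1 := hv v
      have h2 := hXY v
      have h3 := @hp.1 v
      have h4 := @hp.2 v
      have h5 := @hq.1 v
      have h6 := @hq.2 v
      tauto
    · have h1 := hv v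
      have h2 := hXY v
      have h3 := @hp.1 v
      have h4 := @hp.2 v
      have h5 := @hq.1 v
      have h6 := @hq.2 v
      tauto
  · intro H hH
    obtain ⟨φ⟩ := (Finset.mem_filter.1 hH).2
    obtain ⟨S, T, hSs, hTt, hverts, hH⟩ := exists_pair_of_iso_coe φ
    have hST : ∀ v ∈ S, ∀ w ∈ T, G.Adj v w := fun v hv w hw =>
      H.adj_sub ((hH v w).2 (Or.inl ⟨hv, hw⟩))
    -- As `s, t ≥ 1`, there is an edge `xy`; the parts containing its ends determine those
    -- containing all of `S` and `T`.
    obtain ⟨x, hx⟩ : S.Nonempty := Finset.card_pos.1 (by omega)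
    obtain ⟨y, hy⟩ : T.Nonempty := Finset.card_pos.1 (by omega)
    rcases hG.mem_of_adj (hST x hx y hy) with ⟨hxX, hyY⟩ | ⟨hxY, hyX⟩
    · have hm : (T, S) ∈ bicliques G X Y t s := by
        refine mem_bicliques.2 ⟨⟨⟨?_, hTt⟩, ?_, hSs⟩, fun v hv w hw => (hST w hw v hv).symm⟩
        · intro w hw
          exact hG.mem_of_mem_adj hxX (hST x hx w hw)
        · intro v hv
          exact hG.symm.mem_of_mem_adj hyY (hST v hv y hy).symm
      refine ⟨(T, S), Finset.mem_union_right _ hm, ?_⟩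
      refine SimpleGraph.Subgraph.ext (Set.ext fun v => ?_) (funext₂ fun v w => propext ?_)
      · exact or_comm.trans (hverts v).symm
      · exact (hadj hm v w).trans (or_comm.trans (hH v w).symm)
    · have hm : (S, T) ∈ bicliques G X Y s t := by
        refine mem_bicliques.2 ⟨⟨⟨?_, hSs⟩, ?_, hTt⟩, hST⟩
        · intro v hv
          exact hG.mem_of_mem_adj hyX (hST v hv y hy).symm
        · intro w hw
          exact hG.symm.mem_of_mem_adj hxY (hST x hx w hw)
      refine ⟨(S, T), Finset.mem_union_left _ hm, ?_⟩
      refine SimpleGraph.Subgraph.ext (Set.ext fun v => ?_) (funext₂ fun v w => propext ?_)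
      · exact (hverts v).symm
      · exact (hadj hm v w).trans (hH v w).symm

open Classical in
theorem numK_eq [Fintype V] {X Y : Finset V}
    (hG : G.IsBipartiteWith (X : Set V) Y) {s t : ℕ} (hs : 1 ≤ s) (ht : 1 ≤ t) :
    numK s t G = if s = t then (bicliques G X Y s t).card else
      (bicliques G X Y s t).card + (bicliques G X Y t s).card := by
  rw [numK_eq_card_bicliques hG hs ht]
  split_ifs with hst
  · subst hst; rw [Finset.union_self]
  · refine Finset.card_union_of_disjoint (Finset.disjoint_left.2 fun p h1 h2 => hst ?_)
    rw [← (mem_bicliques.1 h1).1.1.2, (mem_bicliques.1 h2).1.1.2]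

theorem card_covered_pairs [DecidableEq V] {X Y A B : Finset V} (hA : A ⊆ X) (hB : B ⊆ Y)
    {m : ℕ} (hm : A.card + B.card = m) (s t : ℕ) :
    ((Y.powersetCard s ×ˢ A.powersetCard t ∪ B.powersetCard s ×ˢ X.powersetCard t).card : ℤ) =
      f s t Y.card X.card m B.card := by
  have hi : (Y.powersetCard s ×ˢ A.powersetCard t) ∩ (B.powersetCard s ×ˢ X.powersetCard t) =
      B.powersetCard s ×ˢ A.powersetCard t := by
    ext p
    simp only [Finset.mem_inter, Finset.mem_product, Finset.mem_powersetCard]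
    constructor
    · tauto
    · rintro ⟨⟨h1, h2⟩, h3, h4⟩
      exact ⟨⟨⟨h1.trans hB, h2⟩, h3, h4⟩, ⟨h1, h2⟩, h3.trans hA, h4⟩
  have h := Finset.card_union_add_card_inter
    (Y.powersetCard s ×ˢ A.powersetCard t) (B.powersetCard s ×ˢ X.powersetCard t)
  rw [hi] at h
  simp only [Finset.card_product, Finset.card_powersetCard] at h
  have hmA : m - B.card = A.card := by omega
  unfold f
  rw [hmA]
  zify at h
  linarith

/-- A vertex of the `X`-side outside `A` forces the whole `Y`-side into `B`. -/
theorem card_bicliques_le {X Y A B : Finset V} (hA : A ⊆ X) (hB : B ⊆ Y)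
    {m : ℕ} (hm : A.card + B.card = m)
    (hcov : ∀ x ∈ X, ∀ y, G.Adj x y → x ∈ A ∨ y ∈ B) (s t : ℕ) :
    ((bicliques G X Y s t).card : ℤ) ≤ f s t Y.card X.card m B.card := by
  classical
  rw [← card_covered_pairs hA hB hm]
  refine Nat.cast_le.2 (Finset.card_le_card fun p hp => ?_)
  obtain ⟨⟨h1, h2⟩, h3⟩ := mem_bicliques.1 hp
  simp only [Finset.mem_union, Finset.mem_product, Finset.mem_powersetCard]
  by_cases hpA : p.2 ⊆ A
  · exact Or.inl ⟨h1, hpA, h2.2⟩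
  · refine Or.inr ⟨⟨fun y hy => ?_, h1.2⟩, h2⟩
    obtain ⟨x, hx, hxA⟩ := Finset.not_subset.1 hpA
    exact (hcov x (h2.1 hx) y (h3 y hy x hx).symm).resolve_left hxA

theorem card_bicliques_eq {X Y A B : Finset V} (hA : A ⊆ X) (hB : B ⊆ Y)
    {m : ℕ} (hm : A.card + B.card = m)
    (hcov : ∀ x ∈ X, ∀ y ∈ Y, G.Adj x y ↔ x ∈ A ∨ y ∈ B)
    (hG : G.IsBipartiteWith (X : Set V) Y) (s t : ℕ) :
    ((bicliques G X Y s t).card : ℤ) = f s t Y.card X.card m B.card := by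
  classical
  refine le_antisymm (card_bicliques_le hA hB hm (fun x hx y hxy =>
    (hcov x hx y (hG.mem_of_mem_adj hx hxy)).1 hxy) s t) ?_
  rw [← card_covered_pairs hA hB hm]
  refine Nat.cast_le.2 (Finset.card_le_card fun p hp => ?_)
  simp only [Finset.mem_union, Finset.mem_product, Finset.mem_powersetCard] at hp
  refine mem_bicliques.2 ?_
  rcases hp with ⟨h1, h2, h3⟩ | ⟨⟨h1, h2⟩, h3⟩
  · exact ⟨⟨h1, h2.trans hA, h3⟩, fun y hy x hx =>
      ((hcov x (hA (h2 hx)) y (h1.1 hy)).2 (Or.inl (h2 hx))).symm⟩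
  · exact ⟨⟨⟨h1.trans hB, h2⟩, h3⟩, fun y hy x hx =>
      ((hcov x (h3.1 hx) y (hB (h1 hy))).2 (Or.inr (h1 hy))).symm⟩

theorem numK_le_fSym [Fintype V] {X Y A B : Finset V} (hA : A ⊆ X) (hB : B ⊆ Y)
    {m : ℕ} (hm : A.card + B.card = m)
    (hcov : ∀ x ∈ X, ∀ y, G.Adj x y → x ∈ A ∨ y ∈ B)
    (hG : G.IsBipartiteWith (X : Set V) Y) {s t : ℕ} (hs : 1 ≤ s) (ht : 1 ≤ t) :
    (numK s t G : ℤ) ≤ fSym s t Y.card X.card m B.card := by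
  have h1 := card_bicliques_le hA hB hm hcov s t
  have h2 := card_bicliques_le hA hB hm hcov t s
  rw [numK_eq hG hs ht]
  unfold fSym
  split_ifs
  · exact h1
  · push_cast; linarith

theorem numK_eq_fSym [Fintype V] {X Y A B : Finset V} (hA : A ⊆ X) (hB : B ⊆ Y)
    {m : ℕ} (hm : A.card + B.card = m)
    (hcov : ∀ x ∈ X, ∀ y ∈ Y, G.Adj x y ↔ x ∈ A ∨ y ∈ B)
    (hG : G.IsBipartiteWith (X : Set V) Y) {s t : ℕ} (hs : 1 ≤ s) (ht : 1 ≤ t) :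
    (numK s t G : ℤ) = fSym s t Y.card X.card m B.card := by
  have h1 := card_bicliques_eq hA hB hm hcov hG s t
  have h2 := card_bicliques_eq hA hB hm hcov hG t s
  rw [numK_eq hG hs ht]
  unfold fSym
  split_ifs
  · exact h1
  · push_cast; linarith

end Counting

/-! ### The upper bound. -/

theorem numK_le_of_not_hasMatching {V : Type*} [Fintype V] {G : SimpleGraph V} {X Y : Set V}
    {b n r s t m : ℕ} (hs : 1 ≤ s) (ht : 1 ≤ t) (hnb : n ≤ b) (hmn : m < n)
    (h : IsConnBip G X Y b n r) (hM : ¬ HasMatching G (m + 1)) :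
    (numK s t G : ℤ) ≤ max (fSym s t b n m r) (fSym s t b n m (m / 2)) := by
  classical
  obtain ⟨hG, hcover, hX, hY, -, hdeg⟩ := h
  lift X to Finset V using Set.toFinite X
  lift Y to Finset V using Set.toFinite Y
  rw [Set.ncard_coe_finset] at hX hY
  subst hX hY
  have hdeg' : ∀ v, r ≤ (G.neighborFinset v).card := fun v =>
    (hdeg.trans (by convert G.minDegree_le_degree v)).trans_eq (G.card_neighborFinset_eq_degree v).symm
  obtain ⟨A, hA, B, hB, hAB, hcov⟩ := exists_cover_of_not_hasMatching hG hmn hM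
  -- The neighbours of the uncovered `x` and `y` lie in `B` and `A` respectively, so both parts of
  -- the cover have at least `r` vertices.
  obtain ⟨x, hx, hxA⟩ := Finset.exists_mem_notMem_of_card_lt_card (s := A) (t := X) (by omega)
  obtain ⟨y, hy, hyB⟩ := Finset.exists_mem_notMem_of_card_lt_card (s := B) (t := Y) (by omega)
  have hrB : r ≤ B.card := (hdeg' x).trans <| Finset.card_le_card fun w hw =>
    (hcov x hx w (by simpa using hw)).resolve_left hxA
  have hrA : r ≤ A.card := (hdeg' y).trans <| Finset.card_le_card fun w hw => by
    have hw : G.Adj y w := by simpa using hw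
    exact (hcov w (hG.symm.mem_of_mem_adj hy hw) y hw.symm).resolve_right hyB
  exact (numK_le_fSym hA hB hAB hcov hG hs ht).trans
    (fSym_le_max hs ht hmn.le hnb hrB (by omega))

/-! ### The extremal graphs. -/

/-- The bipartite graph with parts `Fin n` and `Fin b` in which `x` and `y` are adjacent when `x` is
among the first `c` vertices of its part or `y` is among the first `a` vertices of its part. -/
def coverGraph (n b c a : ℕ) : SimpleGraph (Fin n ⊕ Fin b) where
  Adj
    | Sum.inl x, Sum.inr y => x.1 < c ∨ y.1 < a
    | Sum.inr y, Sum.inl x => x.1 < c ∨ y.1 < a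
    | Sum.inl _, Sum.inl _ => False
    | Sum.inr _, Sum.inr _ => False
  symm := ⟨by rintro (x | x) (y | y) h <;> exact h⟩
  loopless := ⟨by rintro (x | x) h <;> exact h⟩

theorem coverGraph_adj_inl_inr {n b c a : ℕ} {x : Fin n} {y : Fin b} :
    (coverGraph n b c a).Adj (Sum.inl x) (Sum.inr y) ↔ x.1 < c ∨ y.1 < a := Iff.rfl

theorem coverGraph_isBipartiteWith (n b c a : ℕ) :
    (coverGraph n b c a).IsBipartiteWith
      ((Finset.univ.map Function.Embedding.inl : Finset (Fin n ⊕ Fin b)) : Set (Fin n ⊕ Fin b))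
      ((Finset.univ.map Function.Embedding.inr : Finset (Fin n ⊕ Fin b)) :
        Set (Fin n ⊕ Fin b)) where
  disjoint := by
    rw [Set.disjoint_left]
    rintro (v | v) <;> simp
  mem_of_adj := by
    rintro (v | v) (w | w) h
    · exact h.elim
    · simp
    · simp
    · exact h.elim

theorem coverGraph_connected {n b c a : ℕ} (hc : 1 ≤ c) (ha : 1 ≤ a) (hcn : c ≤ n) (hab : a ≤ b) :
    (coverGraph n b c a).Connected := by
  let x0 : Fin n := ⟨0, by omega⟩
  let y0 : Fin b := ⟨0, by omega⟩
  have hx : ∀ x : Fin n, (coverGraph n b c a).Adj (Sum.inl x) (Sum.inr y0) := fun x =>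
    coverGraph_adj_inl_inr.2 (Or.inr ha)
  have hy : ∀ y : Fin b, (coverGraph n b c a).Adj (Sum.inl x0) (Sum.inr y) := fun y =>
    coverGraph_adj_inl_inr.2 (Or.inl hc)
  rw [SimpleGraph.connected_iff_exists_forall_reachable]
  refine ⟨Sum.inl x0, ?_⟩
  rintro (x | y)
  · exact (hy y0).reachable.trans (hx x).reachable.symm
  · exact (hy y).reachable

theorem coverGraph_isConnBip {n b c a r : ℕ} (hr : 1 ≤ r) (hrc : r ≤ c) (hra : r ≤ a) (hcn : c ≤ n)
    (hab : a ≤ b) :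
    IsConnBip (coverGraph n b c a)
      ((Finset.univ.map Function.Embedding.inl : Finset (Fin n ⊕ Fin b)) : Set (Fin n ⊕ Fin b))
      ((Finset.univ.map Function.Embedding.inr : Finset (Fin n ⊕ Fin b)) : Set (Fin n ⊕ Fin b))
      b n r where
  bipartite := coverGraph_isBipartiteWith n b c a
  cover := by
    ext v
    rcases v with v | v <;> simp
  card_left := by rw [Set.ncard_coe_finset]; simp
  card_right := by rw [Set.ncard_coe_finset]; simp
  connected := coverGraph_connected (by omega) (by omega) hcn hab
  le_minDegree := by
    classical
    have : Nonempty (Fin n ⊕ Fin b) := ⟨Sum.inl ⟨0, by omega⟩⟩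
    refine SimpleGraph.le_minDegree_of_forall_le_degree _ _ ?_
    rintro (x | y)
    · rw [← SimpleGraph.card_neighborFinset_eq_degree]
      calc r ≤ ((Finset.univ : Finset (Fin r)).map
            ((Fin.castLEEmb (hra.trans hab)).trans Function.Embedding.inr)).card := by simp
        _ ≤ _ := Finset.card_le_card fun v hv => by
            obtain ⟨i, _, rfl⟩ := Finset.mem_map.1 hv
            rw [SimpleGraph.mem_neighborFinset]
            exact coverGraph_adj_inl_inr.2 (Or.inr (i.2.trans_le hra))
    · rw [← SimpleGraph.card_neighborFinset_eq_degree]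
      calc r ≤ ((Finset.univ : Finset (Fin r)).map
            ((Fin.castLEEmb (hrc.trans hcn)).trans Function.Embedding.inl)).card := by simp
        _ ≤ _ := Finset.card_le_card fun v hv => by
            obtain ⟨i, _, rfl⟩ := Finset.mem_map.1 hv
            rw [SimpleGraph.mem_neighborFinset]
            exact coverGraph_adj_inl_inr (y := y).2 (Or.inl (i.2.trans_le hrc)) |>.symm

theorem fSym_mem_matchingFreeCounts {n b r s t m a : ℕ} (hs : 1 ≤ s) (ht : 1 ≤ t) (hr : 1 ≤ r)
    (hra : r ≤ a) (ham : a + r ≤ m) (hmn : m ≤ n) (hnb : n ≤ b) :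
    fSym s t b n m a ∈ matchingFreeCounts b n r s t (m + 1) := by
  classical
  let A : Finset (Fin n ⊕ Fin b) := (Finset.univ : Finset (Fin (m - a))).map
    ((Fin.castLEEmb (by omega : m - a ≤ n)).trans Function.Embedding.inl)
  let B : Finset (Fin n ⊕ Fin b) := (Finset.univ : Finset (Fin a)).map
    ((Fin.castLEEmb (by omega : a ≤ b)).trans Function.Embedding.inr)
  have hA : A.card = m - a := by simp [A]
  have hB : B.card = a := by simp [B]
  have hAmem : ∀ x : Fin n, Sum.inl x ∈ A ↔ x.1 < m - a := by
    intro x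
    simp only [A, Finset.mem_map, Finset.mem_univ, true_and, Function.Embedding.trans_apply,
      Function.Embedding.inl_apply, Sum.inl.injEq]
    exact ⟨by rintro ⟨i, rfl⟩; exact i.2, fun h => ⟨⟨x, h⟩, rfl⟩⟩
  have hBmem : ∀ y : Fin b, Sum.inr y ∈ B ↔ y.1 < a := by
    intro y
    simp only [B, Finset.mem_map, Finset.mem_univ, true_and, Function.Embedding.trans_apply,
      Function.Embedding.inr_apply, Sum.inr.injEq]
    exact ⟨by rintro ⟨i, rfl⟩; exact i.2, fun h => ⟨⟨y, h⟩, rfl⟩⟩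
  refine ⟨Fin n ⊕ Fin b, inferInstance, coverGraph n b (m - a) a, _, _,
    coverGraph_isConnBip hr (by omega) hra (by omega) (by omega), ?_, ?_⟩
  · rintro ⟨M, hM, hcard⟩
    have h := ncard_edgeSet_le_of_cover hM (A ∪ B) ?_
    · have := Finset.card_union_le A B
      omega
    · simp only [Finset.mem_union]
      rintro (x | x) (y | y) hxy
      · exact hxy.elim
      · exact (coverGraph_adj_inl_inr.1 hxy).imp (fun h => Or.inl ((hAmem x).2 h))
          (fun h => Or.inr ((hBmem y).2 h))
      · exact (coverGraph_adj_inl_inr.1 hxy.symm).symm.imp (fun h => Or.inr ((hBmem x).2 h))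
          (fun h => Or.inl ((hAmem y).2 h))
      · exact hxy.elim
  · have h := numK_eq_fSym (G := coverGraph n b (m - a) a)
      (X := Finset.univ.map Function.Embedding.inl) (Y := Finset.univ.map Function.Embedding.inr)
      (A := A) (B := B) (m := m) (s := s) (t := t) ?_ ?_ (by omega) ?_
      (coverGraph_isBipartiteWith _ _ _ _) hs ht
    · rw [h, hB]
      simp
    · intro v hv
      obtain ⟨i, _, rfl⟩ := Finset.mem_map.1 hv
      simp
    · intro v hv
      obtain ⟨i, _, rfl⟩ := Finset.mem_map.1 hv
      simp
    · intro x hx y hy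
      obtain ⟨x, _, rfl⟩ := Finset.mem_map.1 hx
      obtain ⟨y, _, rfl⟩ := Finset.mem_map.1 hy
      exact coverGraph_adj_inl_inr.trans (or_congr (hAmem x).symm (hBmem y).symm)

end BipTuran
theorem corollary2p3 (b n r s t k : ℕ) (hs : 1 ≤ s) (ht : 1 ≤ t) (hr : 1 ≤ r)
    (hnb : n ≤ b) (hn : 2 * k + 2 * r ≤ n) :
    (∀ {V : Type*} [Fintype V] (G : SimpleGraph V) (X Y : Set V),
      BipTuran.IsConnBip G X Y b n r →
      max (BipTuran.fSym s t b n (n - k - 1) r)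
          (BipTuran.fSym s t b n (n - k - 1) ((n - k - 1) / 2)) < (BipTuran.numK s t G : ℤ) →
      BipTuran.HasMatching G (n - k)) ∧
    (2 * r ≤ n - k - 1 →
      IsGreatest (BipTuran.matchingFreeCounts b n r s t (n - k))
        (max (BipTuran.fSym s t b n (n - k - 1) r)
          (BipTuran.fSym s t b n (n - k - 1) ((n - k - 1) / 2)))) := by
  obtain ⟨m, hm⟩ : ∃ m, n - k = m + 1 := ⟨n - k - 1, by omega⟩
  have hm' : n - k - 1 = m := by omega
  rw [hm', hm]
  refine ⟨fun G X Y h hlt => ?_, fun hrm => ⟨?_, ?_⟩⟩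
  · by_contra hM
    exact (BipTuran.numK_le_of_not_hasMatching hs ht hnb (by omega) h hM).not_gt hlt
  -- Both `a = r` and `a = m / 2` satisfy `r ≤ a` and `a + r ≤ m`, thanks to `2 * r ≤ m`.
  · rcases max_choice (BipTuran.fSym s t b n m r) (BipTuran.fSym s t b n m (m / 2)) with h | h <;>
      rw [h]
    · exact BipTuran.fSym_mem_matchingFreeCounts hs ht hr le_rfl (by omega) (by omega) hnb
    · exact BipTuran.fSym_mem_matchingFreeCounts hs ht hr (by omega) (by omega) (by omega) hnb
  · rintro N ⟨V, _, G, X, Y, h, hM, rfl⟩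
    exact BipTuran.numK_le_of_not_hasMatching hs ht hnb (by omega) h hM
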